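/- Let $(G,+,-,0,<)$ be a linearly ordered abelian group. For $a,b\in G$ write $a\sim b$ if there is an integer $m\ge 1$ with $|a|\le m|b|$ and $|b|\le m|a|$, let $v_G(a)=[a]$ be the $\sim$-class of $a$, and order the classes by $[a]<[b]$ iff $|a|>|b|$ and $a\not\sim b$. Put $\Gamma:=v_G(G\setminus\{0\})$ with this linear order. For $g\in G\setminus\{0\}$ let $A(g)$ be the union of all convex subgroups of $G$ not containing $g$, let $B(g)$ be the intersection of all convex subgroups of $G$ containing $g$, and let $C(g):=B(g)/A(g)$. Let \[ \mathrm{drk}_G:=\{H\mid H\subsetneq G\text{ a convex subgroup, definable with parameters in } (G,+,-,0,<)\}, \] \[ \mathrm{drk}_\Gamma:=\{\Delta\mid \Delta\subsetneq\Gamma\text{ a final segment, definable with parameters in } (\Gamma,<)\}, \] where definability is first-order and $\{0\}$, respectively $\emptyset$, is allowed as a subgroup, respectively final segment. For a convex subgroup $H$ put $\Phi_G(H):=v_G(H\setminus\{0\})$. **Proposition.** Suppose that there is an integer $n\ge 2$ such that for every $g\in G\setminus\{0\}$ the group $C(g)$ is not $n$-divisible (i.e. $nC(g)\ne C(g)$).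 Then $\mathrm{drk}_\Gamma\subseteq\Phi_G(\mathrm{drk}_G)$, i.e. every $\Delta\in\mathrm{drk}_\Gamma$ equals $\Phi_G(H)$ for some $H\in\mathrm{drk}_G$. -/

import Mathlib

namespace DefinableRank

open FirstOrder

/-! ### The languages of ordered sets and of ordered groups -/

/-- The relation symbols shared by both languages: one binary symbol `<`. -/
inductive LtRel : ℕ → Type
  | lt : LtRel 2

/-- The function symbols `+`, `-` (unary) and `0`. -/
inductive GroupFunc : ℕ → Type
  | add : GroupFunc 2
  | neg : GroupFunc 1
  | zero : GroupFunc 0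

/-- The language `{<}` of ordered sets. -/
def orderedSetLang : Language := ⟨fun _ => Empty, LtRel⟩

/-- The language `{+, -, 0, <}` of ordered groups. -/
def orderedGroupLang : Language := ⟨GroupFunc, LtRel⟩

/-- An ordered set as a structure in the language `{<}`. -/
instance orderedSetStructure (M : Type*) [LinearOrder M] : orderedSetLang.Structure M where
  funMap f := nomatch f
  RelMap
    | .lt => fun x => x 0 < x 1

/-- An ordered abelian group as a structure in the language `{+, -, 0, <}`. -/
instance orderedGroupStructure (G : Type*) [AddCommGroup G] [LinearOrder G] :
    orderedGroupLang.Structure G where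
  funMap
    | .add => fun x => x 0 + x 1
    | .neg => fun x => -(x 0)
    | .zero => fun _ => 0
  RelMap
    | .lt => fun x => x 0 < x 1

/-! ### Ranks and definable ranks -/

section OrderedSet

variable (S : Type*) [LinearOrder S]

/-- The rank of an ordered set: its proper final segments (the empty one included). -/
def setRank : Set (Set S) :=
  {D | IsUpperSet D ∧ D ≠ Set.univ}

/-- The definable rank of an ordered set: its proper final segments that are definable, with
parameters, in the language `{<}`. -/
def setDefinableRank : Set (Set S) :=
  {D | D ∈ setRank S ∧ (Set.univ : Set S).Definable₁ orderedSetLang D}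

end OrderedSet

section OrderedGroup

variable (G : Type*) [AddCommGroup G] [LinearOrder G]

/-- The set of all convex subgroups. -/
def convexSubgroups : Set (AddSubgroup G) :=
  {H | (H : Set G).OrdConnected}

/-- The rank of an ordered abelian group: its proper convex subgroups. -/
def groupRank : Set (AddSubgroup G) :=
  {H | H ∈ convexSubgroups G ∧ H ≠ ⊤}

/-- The definable rank of an ordered abelian group: its proper convex subgroups that are
definable, with parameters, in the language `{+, -, 0, <}`. -/
def groupDefinableRank : Set (AddSubgroup G) :=
  {H | H ∈ groupRank G ∧ (Set.univ : Set G).Definable₁ orderedGroupLang (H : Set G)}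

end OrderedGroup

section Components

variable {G : Type*} [AddCommGroup G] [LinearOrder G]

/-- `A(g)`, for `g ≠ 0` the union of the convex subgroups that do not contain `g`
(see `coe_subgroupA`). -/
def subgroupA (g : G) : AddSubgroup G :=
  sSup {H | H ∈ convexSubgroups G ∧ g ∉ H}

/-- `B(g)`, the intersection of the convex subgroups that contain `g`. -/
def subgroupB (g : G) : AddSubgroup G :=
  sInf {H | H ∈ convexSubgroups G ∧ g ∈ H}

/-- The archimedean component `C(g) = B(g) / A(g)`. -/
abbrev componentC (g : G) : Type _ :=
  subgroupB g ⧸ (subgroupA g).addSubgroupOf (subgroupB g)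

/-- An abelian group `A` is `n`-divisible if `nA = A`. -/
def IsNDivisible (n : ℕ) (A : Type*) [AddCommGroup A] : Prop :=
  ∀ a : A, ∃ b : A, n • b = a

theorem coe_subgroupB (g : G) :
    (subgroupB g : Set G) = ⋂ H ∈ {H | H ∈ convexSubgroups G ∧ g ∈ H}, (H : Set G) :=
  AddSubgroup.coe_sInf _

variable [IsOrderedAddMonoid G]

/-- Convex subgroups are linearly ordered by inclusion. -/
theorem convexSubgroups_total {H K : AddSubgroup G} (hH : H ∈ convexSubgroups G)
    (hK : K ∈ convexSubgroups G) : H ≤ K ∨ K ≤ H := by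
  by_contra! h
  obtain ⟨h1, h2⟩ := h
  obtain ⟨x, hxH, hxK⟩ := SetLike.not_le_iff_exists.mp h1
  obtain ⟨y, hyK, hyH⟩ := SetLike.not_le_iff_exists.mp h2
  have key : ∀ (L : AddSubgroup G), L ∈ convexSubgroups G → ∀ a b : G, a ∈ L → |b| ≤ |a| →
      b ∈ L := by
    intro L hL a b ha hab
    have ha' : |a| ∈ L := by
      rcases abs_choice a with h | h <;> rw [h]
      · exact ha
      · exact L.neg_mem ha
    exact Set.OrdConnected.out (s := (L : Set G)) hL (L.neg_mem ha') ha' (abs_le.mp hab)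
  rcases le_total |x| |y| with h | h
  · exact hxK (key K hK y x hyK h)
  · exact hyH (key H hH x y hxH h)

theorem coe_subgroupA {g : G} (hg : g ≠ 0) :
    (subgroupA g : Set G) = ⋃ H ∈ {H | H ∈ convexSubgroups G ∧ g ∉ H}, (H : Set G) := by
  have hne : {H | H ∈ convexSubgroups G ∧ g ∉ H}.Nonempty := by
    refine ⟨⊥, ?_, by simpa using hg⟩
    show ((⊥ : AddSubgroup G) : Set G).OrdConnected
    rw [AddSubgroup.coe_bot]
    exact Set.ordConnected_singleton
  have hdir : DirectedOn (· ≤ ·) {H | H ∈ convexSubgroups G ∧ g ∉ H} := by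
    intro H hH K hK
    rcases convexSubgroups_total hH.1 hK.1 with h | h
    · exact ⟨K, hK, h, le_rfl⟩
    · exact ⟨H, hH, le_rfl, h⟩
  ext x
  rw [SetLike.mem_coe, subgroupA, AddSubgroup.mem_sSup_of_directedOn hne hdir]
  simp only [Set.mem_iUnion, SetLike.mem_coe, exists_prop]

theorem subgroupA_le_subgroupB (g : G) : subgroupA g ≤ subgroupB g := by
  refine sSup_le fun H hH => le_sInf fun K hK => ?_
  rcases convexSubgroups_total hH.1 hK.1 with h | h
  · exact h
  · exact absurd (h hK.2) hH.2

end Components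

section ValueSet

variable (G : Type*) [AddCommGroup G] [LinearOrder G] [IsOrderedAddMonoid G]

/-- The value set `v_G(G \ {0})` of the natural valuation `v_G(g) = [g]`: the archimedean classes
of nonzero elements, where `[a] < [b]` iff `n|b| < |a|` for all `n`. -/
abbrev ValueSet : Type _ := FiniteArchimedeanClass G

variable {G}

/-- The map `H ↦ v_G(H \ {0})`. -/
def rankMap (H : AddSubgroup G) : Set (ValueSet G) :=
  {γ | ∃ (h : G) (h0 : h ≠ 0), h ∈ H ∧ FiniteArchimedeanClass.mk h h0 = γ}

end ValueSet

end DefinableRank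

/-!
The theorem rests on the fact that, under the divisibility hypothesis, the relation `[a] < [b]` on
nonzero elements is first-order definable in the ordered group `G`. Fix `n` such that no component
`C(g)` is `n`-divisible. Then, for nonzero `a` and `b`,

  `[a] < [b]` iff there is a coset `c + nG` that meets the interval `{u | |u| ≤ |n a|}` but not the
  interval `{u | |u| ≤ |n b|}`

(`mk_lt_mk_iff_exists_coset`). If `[a] < [b]`, a representative `c ∈ B(a)` of an element of `C(a)`
that is not divisible by `n` gives such a coset: elements of `B(a)` can be reduced modulo `n a`, and
no element of `c + nG` lies in `A(a)`, which contains `n b`. Conversely, if `[b] ≤ [a]`, an element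
of the coset that is at most `|n a|` is bounded by a multiple of `n b`, and reducing it modulo `n b`
gives an element of the same coset that is at most `|n b|`.

Hence the ordered set `Γ` is interpretable in `G`, its elements being represented by nonzero
elements of `G`: by recursion on formulas, every formula in the language of `Γ` translates to a
formula in the language of `G` (`exists_groupFormula_realize_iff`), where quantifiers are
relativized to nonzero elements and parameters are replaced by representatives. The translation of
a formula that defines a final segment `Δ` defines, up to `0`, the convex subgroup
`{g | g = 0 ∨ [g] ∈ Δ}`, whose image under `Φ_G` is `Δ`.
-/

namespace DefinableRank

open FirstOrder FirstOrder.Language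

/-! ### The subgroups `A(g)` and `B(g)` in terms of archimedean classes -/

section Components

variable {G : Type*} [AddCommGroup G] [LinearOrder G] [IsOrderedAddMonoid G]

theorem mem_of_mem_convexSubgroups {H : AddSubgroup G} (hH : H ∈ convexSubgroups G) {a b : G}
    (ha : a ∈ H) (hab : |b| ≤ |a|) : b ∈ H := by
  have ha' : |a| ∈ H := by
    rcases abs_choice a with h | h <;> rw [h]
    exacts [ha, H.neg_mem ha]
  exact Set.OrdConnected.out (s := (H : Set G)) hH (H.neg_mem ha') ha' (abs_le.mp hab)

theorem mem_convexSubgroups_of_abs_le {H : AddSubgroup G}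
    (h : ∀ a ∈ H, ∀ b : G, |b| ≤ |a| → b ∈ H) : H ∈ convexSubgroups G := by
  refine ⟨fun x hx y hy z hz => ?_⟩
  rcases le_total 0 z with h0 | h0
  · exact h y hy z (abs_le_abs_of_nonneg h0 hz.2)
  · exact h x hx z (abs_le_abs_of_nonpos h0 hz.1)

theorem mem_subgroupB_iff {a x : G} :
    x ∈ subgroupB a ↔ ArchimedeanClass.mk a ≤ ArchimedeanClass.mk x := by
  constructor
  · intro hx
    have hle : subgroupB a ≤ ArchimedeanClass.closedBallAddSubgroup (ArchimedeanClass.mk a) := by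
      refine sInf_le ⟨mem_convexSubgroups_of_abs_le fun u hu w hw => ?_, ?_⟩
      · rw [ArchimedeanClass.mem_closedBallAddSubgroup_iff] at hu ⊢
        exact hu.trans (ArchimedeanClass.mk_le_mk_of_abs hw)
      · exact ArchimedeanClass.mem_closedBallAddSubgroup_iff.2 le_rfl
    exact ArchimedeanClass.mem_closedBallAddSubgroup_iff.1 (hle hx)
  · intro hx
    obtain ⟨m, hm⟩ := ArchimedeanClass.mk_le_mk.1 hx
    refine AddSubgroup.mem_sInf.2 fun H hH => ?_
    refine mem_of_mem_convexSubgroups hH.1 (H.nsmul_mem hH.2 m) ?_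
    rwa [abs_nsmul]

theorem mem_subgroupA_of_mk_lt_mk {a x : G} (ha : a ≠ 0)
    (hx : ArchimedeanClass.mk a < ArchimedeanClass.mk x) : x ∈ subgroupA a := by
  have htop : ArchimedeanClass.mk a ≠ ⊤ := fun h => ha (ArchimedeanClass.mk_eq_top_iff.1 h)
  have hle : ArchimedeanClass.ballAddSubgroup (ArchimedeanClass.mk a) ≤ subgroupA a := by
    refine le_sSup ⟨mem_convexSubgroups_of_abs_le fun u hu w hw => ?_, ?_⟩
    · rw [ArchimedeanClass.mem_ballAddSubgroup_iff htop] at hu ⊢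
      exact hu.trans_le (ArchimedeanClass.mk_le_mk_of_abs hw)
    · simp [ArchimedeanClass.mem_ballAddSubgroup_iff htop]
  exact hle ((ArchimedeanClass.mem_ballAddSubgroup_iff htop).2 hx)

/-! ### A definition of the order of archimedean classes by cosets of `nG` -/

/-- An element that is bounded by a multiple of `w` can be reduced modulo `w`. -/
theorem exists_abs_add_zsmul_le (w : G) (m : ℕ) (u : G) (hu : |u| ≤ m • |w|) :
    ∃ j : ℤ, |u + j • w| ≤ |w| := by
  wlog hw : 0 ≤ w generalizing w
  · obtain ⟨j, hj⟩ := this (-w) (by rwa [abs_neg]) (by simpa using (not_le.1 hw).le)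
    exact ⟨-j, by simpa using hj⟩
  rw [abs_of_nonneg hw] at hu ⊢
  induction m generalizing u with
  | zero => exact ⟨0, by simpa using hu.trans (by simpa using hw)⟩
  | succ m ih =>
    rw [succ_nsmul] at hu
    obtain ⟨hu₁, hu₂⟩ := abs_le.1 hu
    have hmw : 0 ≤ m • w := nsmul_nonneg hw m
    by_cases hsmall : |u| ≤ w
    · exact ⟨0, by simpa using hsmall⟩
    rcases le_total 0 u with h0 | h0
    · rw [abs_of_nonneg h0, not_le] at hsmall
      obtain ⟨j, hj⟩ := ih (u - w) <| by
        rw [abs_of_nonneg (sub_nonneg.2 hsmall.le)]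
        exact sub_le_iff_le_add.2 hu₂
      refine ⟨j - 1, ?_⟩
      rwa [sub_smul, one_smul, add_sub, add_sub_right_comm]
    · rw [abs_of_nonpos h0, not_le] at hsmall
      obtain ⟨j, hj⟩ := ih (u + w) <| by
        have : u + w ≤ 0 := by simpa [add_comm u] using add_le_add_right (neg_le_neg hsmall.le) w
        rw [abs_of_nonpos this, neg_add, ← sub_eq_add_neg]
        exact sub_le_iff_le_add.2 (neg_le.1 hu₁)
      refine ⟨j + 1, ?_⟩
      rwa [add_smul, one_smul, add_comm (j • w), ← add_assoc]

theorem exists_abs_add_nsmul_le {n : ℕ} {c b : G} {m : ℕ} (hc : |c| ≤ m • |n • b|) :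
    ∃ x, |c + n • x| ≤ |n • b| := by
  obtain ⟨j, hj⟩ := exists_abs_add_zsmul_le (n • b) m c hc
  exact ⟨j • b, by rwa [smul_comm]⟩

theorem mk_nsmul_eq {n : ℕ} (hn : n ≠ 0) (a : G) :
    ArchimedeanClass.mk (n • a) = ArchimedeanClass.mk a := by
  refine le_antisymm (ArchimedeanClass.mk_le_mk_of_abs ?_)
    (ArchimedeanClass.mk_le_mk.2 ⟨n, (abs_nsmul n a).le⟩)
  rw [abs_nsmul]
  exact le_self_nsmul (abs_nonneg a) hn

/-- If `C(a)` is not `n`-divisible, `[a] < [b]` is a first-order condition on `a` and `b`. -/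
theorem mk_lt_mk_iff_exists_coset {n : ℕ} (hn : n ≠ 0) {a b : G} (ha : a ≠ 0)
    (hC : ¬ IsNDivisible n (componentC a)) :
    ArchimedeanClass.mk a < ArchimedeanClass.mk b ↔
      ∃ c, (¬ ∃ x, |c + n • x| ≤ |n • b|) ∧ ∃ x, |c + n • x| ≤ |n • a| := by
  constructor
  · intro hab
    simp only [IsNDivisible, not_forall, not_exists] at hC
    obtain ⟨q, hq⟩ := hC
    obtain ⟨⟨c, hcB⟩, rfl⟩ := QuotientAddGroup.mk_surjective q
    refine ⟨c, ?_, ?_⟩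
    · rintro ⟨x, hx⟩
      have hA : c + n • x ∈ subgroupA a := by
        refine mem_subgroupA_of_mk_lt_mk ha (hab.trans_le ?_)
        rw [← mk_nsmul_eq hn b]
        exact ArchimedeanClass.mk_le_mk_of_abs hx
      have hxB : x ∈ subgroupB a := by
        have h := AddSubgroup.sub_mem _ (subgroupA_le_subgroupB a hA) hcB
        rwa [add_sub_cancel_left, mem_subgroupB_iff, mk_nsmul_eq hn, ← mem_subgroupB_iff] at h
      refine hq (QuotientAddGroup.mk (-⟨x, hxB⟩)) ?_
      rw [← QuotientAddGroup.mk_nsmul, QuotientAddGroup.eq, AddSubgroup.mem_addSubgroupOf]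
      simpa [add_comm] using hA
    · obtain ⟨m, hm⟩ := ArchimedeanClass.mk_le_mk.1
        ((mk_nsmul_eq hn a).le.trans (mem_subgroupB_iff.1 hcB))
      exact exists_abs_add_nsmul_le hm
  · rintro ⟨c, hcb, x, hx⟩
    by_contra hab
    refine hcb ?_
    have hle : ArchimedeanClass.mk (n • b) ≤ ArchimedeanClass.mk (c + n • x) := by
      rw [mk_nsmul_eq hn]
      refine (not_lt.1 hab).trans ?_
      rw [← mk_nsmul_eq hn a]
      exact ArchimedeanClass.mk_le_mk_of_abs hx
    obtain ⟨m, hm⟩ := ArchimedeanClass.mk_le_mk.1 hle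
    obtain ⟨y, hy⟩ := exists_abs_add_nsmul_le hm
    exact ⟨x + y, by rwa [nsmul_add, ← add_assoc]⟩

end Components

/-! ### Formulas in the language of ordered groups -/

section Formulas

variable {α : Type*} {k : ℕ}

/-- The term `0`. -/
def zeroTerm : orderedGroupLang.Term α :=
  Constants.term (L := orderedGroupLang) GroupFunc.zero

/-- The term `t + s`. -/
def addTerm (t s : orderedGroupLang.Term α) : orderedGroupLang.Term α :=
  Functions.apply₂ (L := orderedGroupLang) GroupFunc.add t s

/-- The term `-t`. -/
def negTerm (t : orderedGroupLang.Term α) : orderedGroupLang.Term α :=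
  Functions.apply₁ (L := orderedGroupLang) GroupFunc.neg t

/-- The term `t + ⋯ + t` with `n` summands. -/
def nsmulTerm (n : ℕ) (t : orderedGroupLang.Term α) : orderedGroupLang.Term α :=
  n.rec zeroTerm fun _ s => addTerm s t

/-- The formula `t ≤ s`, written as `¬ s < t`. -/
def leFormula (t s : orderedGroupLang.Term (α ⊕ Fin k)) : orderedGroupLang.BoundedFormula α k :=
  ∼(Relations.boundedFormula₂ (L := orderedGroupLang) LtRel.lt s t)

/-- The formula `|t| ≤ |s|`. -/
def absLeFormula (t s : orderedGroupLang.Term (α ⊕ Fin k)) : orderedGroupLang.BoundedFormula α k :=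
  (leFormula t s ⊔ leFormula t (negTerm s)) ⊓
    (leFormula (negTerm t) s ⊔ leFormula (negTerm t) (negTerm s))

/-- The formula, in the free variables `a = 0` and `b = 1`, which says that some coset `c + nG`
contains no `u` with `|u| ≤ |n b|` but contains some `u` with `|u| ≤ |n a|`. -/
def cosetFormula (n : ℕ) : orderedGroupLang.Formula (Fin 2) :=
  let bound (i : Fin 2) : orderedGroupLang.BoundedFormula (Fin 2) 1 :=
    ∃' absLeFormula (addTerm (&0) (nsmulTerm n (&1))) (nsmulTerm n (Term.var (Sum.inl i)))
  ∃' (∼(bound 1) ⊓ bound 0)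

variable {G : Type*} [AddCommGroup G] [LinearOrder G]

@[simp]
theorem realize_zeroTerm (v : α → G) : (zeroTerm : orderedGroupLang.Term α).realize v = 0 :=
  Term.realize_constants

@[simp]
theorem realize_addTerm (t s : orderedGroupLang.Term α) (v : α → G) :
    (addTerm t s).realize v = t.realize v + s.realize v :=
  Term.realize_functions_apply₂

@[simp]
theorem realize_negTerm (t : orderedGroupLang.Term α) (v : α → G) :
    (negTerm t).realize v = -t.realize v :=
  Term.realize_functions_apply₁

@[simp]
theorem realize_nsmulTerm (n : ℕ) (t : orderedGroupLang.Term α) (v : α → G) :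
    (nsmulTerm n t).realize v = n • t.realize v := by
  induction n with
  | zero => rw [zero_nsmul]; exact realize_zeroTerm v
  | succ n ih =>
    rw [succ_nsmul, ← ih]
    exact realize_addTerm _ _ v

@[simp]
theorem realize_leFormula (t s : orderedGroupLang.Term (α ⊕ Fin k)) (v : α → G) (xs : Fin k → G) :
    (leFormula t s).Realize v xs ↔ t.realize (Sum.elim v xs) ≤ s.realize (Sum.elim v xs) :=
  (not_congr BoundedFormula.realize_rel₂).trans not_lt

@[simp]
theorem realize_absLeFormula [IsOrderedAddMonoid G] (t s : orderedGroupLang.Term (α ⊕ Fin k))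
    (v : α → G) (xs : Fin k → G) :
    (absLeFormula t s).Realize v xs ↔
      |t.realize (Sum.elim v xs)| ≤ |s.realize (Sum.elim v xs)| := by
  simp only [absLeFormula, BoundedFormula.realize_inf, BoundedFormula.realize_sup,
    realize_leFormula, realize_negTerm]
  rw [abs_le', le_abs, le_abs]

theorem realize_cosetFormula [IsOrderedAddMonoid G] (n : ℕ) (v : Fin 2 → G) :
    (cosetFormula n).Realize v ↔
      ∃ c, (¬ ∃ x, |c + n • x| ≤ |n • v 1|) ∧ ∃ x, |c + n • x| ≤ |n • v 0| := by
  simp only [cosetFormula, Formula.Realize, BoundedFormula.realize_ex, BoundedFormula.realize_inf,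
    BoundedFormula.realize_not, realize_absLeFormula, realize_addTerm, realize_nsmulTerm,
    Term.realize_var, Sum.elim_inl]
  rfl

end Formulas

/-! ### Interpretation of the value set in the group -/

section Interpretation

variable {G : Type*} [AddCommGroup G] [LinearOrder G] [IsOrderedAddMonoid G]

/-- The language of ordered sets has no function symbols, so its terms are variables. -/
theorem exists_eq_var {α : Type*} (t : orderedSetLang.Term α) : ∃ i, t = Term.var i := by
  cases t with
  | var i => exact ⟨i, rfl⟩
  | func f _ => exact nomatch f

/-- The class of a nonzero element. -/
def valueClass (g : {g : G // g ≠ 0}) : ValueSet G :=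
  FiniteArchimedeanClass.mk g.1 g.2

theorem valueClass_surjective : Function.Surjective (valueClass (G := G)) := fun γ =>
  FiniteArchimedeanClass.ind (motive := fun γ => ∃ g, valueClass g = γ)
    (fun a ha => ⟨⟨a, ha⟩, rfl⟩) γ

theorem sumElim_comp {α β X Y : Type*} (f : X → Y) (v : α → X) (w : β → X) (i : α ⊕ β) :
    Sum.elim (fun i => f (v i)) (fun j => f (w j)) i = f (Sum.elim v w i) := by
  cases i <;> rfl

theorem snoc_comp {k : ℕ} {X Y : Type*} (f : X → Y) (xs : Fin k → X) (x : X) :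
    (Fin.snoc (fun i => f (xs i)) (f x) : Fin (k + 1) → Y) =
      fun i => f ((Fin.snoc xs x : Fin (k + 1) → X) i) := by
  funext i
  refine Fin.lastCases ?_ (fun j => ?_) i <;> simp

/-- If the formula `θ` defines the order of the classes of nonzero elements, every formula about
classes translates to a formula about their representatives. -/
theorem exists_groupFormula_realize_iff {θ : orderedGroupLang.Formula (Fin 2)}
    (hθ : ∀ a b : {g : G // g ≠ 0}, θ.Realize ![a.1, b.1] ↔ valueClass a < valueClass b)
    {α : Type*} {k : ℕ} (φ : orderedSetLang.BoundedFormula α k) :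
    ∃ ψ : orderedGroupLang.BoundedFormula α k,
      ∀ (v : α → {g : G // g ≠ 0}) (xs : Fin k → {g : G // g ≠ 0}),
        ψ.Realize (fun i => (v i : G)) (fun i => (xs i : G)) ↔
          φ.Realize (fun i => valueClass (v i)) (fun i => valueClass (xs i)) := by
  have key : ∀ {k : ℕ} (i j : α ⊕ Fin k), ∃ ψ : orderedGroupLang.BoundedFormula α k,
      ∀ (v : α → {g : G // g ≠ 0}) (xs : Fin k → {g : G // g ≠ 0}),
        ψ.Realize (fun i => (v i : G)) (fun i => (xs i : G)) ↔
          valueClass (Sum.elim v xs i) < valueClass (Sum.elim v xs j) := by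
    intro k i j
    refine ⟨BoundedFormula.relabel (k := 0) (![i, j] : Fin 2 → α ⊕ Fin k) θ, fun v xs => ?_⟩
    rw [← hθ, BoundedFormula.realize_relabel, Formula.Realize]
    refine iff_of_eq (congr_arg₂ _ ?_ (Subsingleton.elim _ _))
    funext l
    fin_cases l
    · exact sumElim_comp Subtype.val v xs i
    · exact sumElim_comp Subtype.val v xs j
  induction φ with
  | falsum => exact ⟨⊥, fun _ _ => Iff.rfl⟩
  | equal t s =>
    obtain ⟨i, rfl⟩ := exists_eq_var t
    obtain ⟨j, rfl⟩ := exists_eq_var s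
    obtain ⟨ψ₁, h₁⟩ := key i j
    obtain ⟨ψ₂, h₂⟩ := key j i
    -- equality of classes need not be equality of representatives: it is expressed by the order
    refine ⟨∼ψ₁ ⊓ ∼ψ₂, fun v xs => ?_⟩
    rw [BoundedFormula.realize_inf, BoundedFormula.realize_not, BoundedFormula.realize_not, h₁, h₂,
      not_lt, not_lt, and_comm, ← le_antisymm_iff, ← sumElim_comp valueClass,
      ← sumElim_comp valueClass]
    rfl
  | rel R ts =>
    cases R
    obtain ⟨i, hi⟩ := exists_eq_var (ts 0)
    obtain ⟨j, hj⟩ := exists_eq_var (ts 1)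
    obtain ⟨ψ, h⟩ := key i j
    refine ⟨ψ, fun v xs => ?_⟩
    rw [h, ← sumElim_comp valueClass, ← sumElim_comp valueClass]
    change _ ↔ (ts 0).realize _ < (ts 1).realize _
    rw [hi, hj]
    rfl
  | imp _ _ ih₁ ih₂ =>
    obtain ⟨ψ₁, h₁⟩ := ih₁
    obtain ⟨ψ₂, h₂⟩ := ih₂
    refine ⟨ψ₁.imp ψ₂, fun v xs => ?_⟩
    rw [BoundedFormula.realize_imp, BoundedFormula.realize_imp, h₁, h₂]
  | @all k _ ih =>
    obtain ⟨ψ, h⟩ := ih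
    -- the quantifier over classes becomes a quantifier over nonzero elements
    refine ⟨∀' (∼(Term.bdEqual (&(Fin.last k)) zeroTerm) ⟹ ψ), fun v xs => ?_⟩
    rw [BoundedFormula.realize_all, BoundedFormula.realize_all, valueClass_surjective.forall]
    simp only [BoundedFormula.realize_imp, BoundedFormula.realize_not,
      BoundedFormula.realize_bdEqual, Function.comp_apply, Term.realize_var, Sum.elim_inr, Fin.snoc_last,
      realize_zeroTerm, snoc_comp valueClass, ← h, ← snoc_comp Subtype.val]
    exact ⟨fun H x => H x.1 x.2, fun H x hx => H ⟨x, hx⟩⟩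

/-- The convex subgroup `{g | g = 0 ∨ [g] ∈ D}` of a definable final segment `D` is definable if the
order of the classes of nonzero elements is. -/
theorem definable_subgroup_of_definable {θ : orderedGroupLang.Formula (Fin 2)}
    (hθ : ∀ a b : {g : G // g ≠ 0}, θ.Realize ![a.1, b.1] ↔ valueClass a < valueClass b)
    {D : UpperSet (ValueSet G)}
    (hD : (Set.univ : Set (ValueSet G)).Definable₁ orderedSetLang (D : Set (ValueSet G))) :
    (Set.univ : Set G).Definable₁ orderedGroupLang
      (FiniteArchimedeanClass.addSubgroup D : Set G) := by
  obtain ⟨φ, hφ⟩ := Set.definable_iff_exists_formula_sum.1 hD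
  obtain ⟨ψ, hψ⟩ := exists_groupFormula_realize_iff hθ φ
  choose rep hrep using valueClass_surjective (G := G)
  -- parameters from the value set are replaced by representatives in the group
  let r (γ : (Set.univ : Set (ValueSet G))) : (Set.univ : Set G) := ⟨(rep γ).1, trivial⟩
  refine Set.definable_iff_exists_formula_sum.2
    ⟨∼(Term.equal (Term.var (Sum.inr 0)) zeroTerm) ⟹ Formula.relabel (Sum.map r id) ψ, ?_⟩
  ext v
  have hmem : ∀ h : v 0 ≠ 0, FiniteArchimedeanClass.mk (v 0) h ∈ D ↔
      Formula.Realize (Formula.relabel (Sum.map r id) ψ) (Sum.elim (↑) v) := by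
    intro h
    have h₁ := hψ (Sum.elim (fun γ => rep γ) fun _ => ⟨v 0, h⟩) Fin.elim0
    have h₂ := Set.ext_iff.1 hφ fun _ => FiniteArchimedeanClass.mk (v 0) h
    refine h₂.trans (Iff.trans ?_ (h₁.symm.trans ?_))
    · change BoundedFormula.Realize φ _ _ ↔ _
      refine iff_of_eq (congr_arg₂ _ ?_ (Subsingleton.elim _ _))
      funext i
      rcases i with γ | i
      exacts [(hrep γ).symm, rfl]
    · rw [Formula.realize_relabel]
      refine iff_of_eq (congr_arg₂ _ ?_ (Subsingleton.elim _ _))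
      funext i
      rcases i with γ | i
      exacts [rfl, congr_arg v (Subsingleton.elim _ _)]
  simp only [Set.mem_ofPred_eq, SetLike.mem_coe, FiniteArchimedeanClass.mem_addSubgroup_iff,
    Formula.realize_imp, Formula.realize_not, Formula.realize_equal, Term.realize_var,
    Sum.elim_inr, realize_zeroTerm]
  exact forall_congr' hmem

theorem rankMap_addSubgroup (D : UpperSet (ValueSet G)) :
    rankMap (FiniteArchimedeanClass.addSubgroup D) = (D : Set (ValueSet G)) := by
  ext γ
  constructor
  · rintro ⟨g, hg, hgD, rfl⟩
    exact FiniteArchimedeanClass.mem_addSubgroup_iff.1 hgD hg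
  · intro hγ
    obtain ⟨g, rfl⟩ := valueClass_surjective γ
    exact ⟨g.1, g.2, FiniteArchimedeanClass.mem_addSubgroup_iff.2 fun _ => hγ, rfl⟩

theorem addSubgroup_mem_groupRank {D : UpperSet (ValueSet G)}
    (hD : (D : Set (ValueSet G)) ≠ Set.univ) :
    FiniteArchimedeanClass.addSubgroup D ∈ groupRank G := by
  refine ⟨mem_convexSubgroups_of_abs_le fun a ha b hab => ?_, fun htop => hD ?_⟩
  · rw [FiniteArchimedeanClass.mem_addSubgroup_iff] at ha ⊢
    intro hb
    have ha0 : a ≠ 0 := by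
      rintro rfl
      exact hb (by simpa using hab)
    exact D.upper (ArchimedeanClass.mk_le_mk_of_abs hab) (ha ha0)
  · rw [← rankMap_addSubgroup, htop]
    refine Set.eq_univ_of_forall fun γ => ?_
    obtain ⟨g, rfl⟩ := valueClass_surjective γ
    exact ⟨g.1, g.2, AddSubgroup.mem_top _, rfl⟩

end Interpretation

end DefinableRank

theorem mainTheorem9 {G : Type*} [AddCommGroup G] [LinearOrder G] [IsOrderedAddMonoid G]
    (h : ∃ n : ℕ, 2 ≤ n ∧
      ∀ g : G, g ≠ 0 → ¬ DefinableRank.IsNDivisible n (DefinableRank.componentC g)) :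
    DefinableRank.setDefinableRank (DefinableRank.ValueSet G) ⊆
      DefinableRank.rankMap '' DefinableRank.groupDefinableRank G := by
  obtain ⟨n, hn, hC⟩ := h
  rintro D ⟨⟨hup, huniv⟩, hdef⟩
  refine ⟨FiniteArchimedeanClass.addSubgroup ⟨D, hup⟩,
    ⟨DefinableRank.addSubgroup_mem_groupRank huniv, ?_⟩, DefinableRank.rankMap_addSubgroup _⟩
  refine DefinableRank.definable_subgroup_of_definable
    (θ := DefinableRank.cosetFormula n) (fun a b => ?_) hdef
  rw [DefinableRank.realize_cosetFormula]
  exact (DefinableRank.mk_lt_mk_iff_exists_coset (by omega) a.2 (hC a.1 a.2)).symm
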